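/- Let $N\ge 2$, $1<p<\frac{N+3}{N-1}$ and $1<q<\frac{N+2}{N}$. For $M>0$ and a domain $\Omega\subset\mathbb{R}^N$ (a nonempty connected open set), a solution in $\Omega$ is a function $u\in C^2(\Omega)$ satisfying $$-\Delta u=|u|^{p-1}u+M|\nabla u|^q\quad\text{in }\Omega. \tag{1}$$ Then there exist constants $a>0$ and $c>0$, depending only on $N,p,q$, such that for every domain $\Omega\subset\mathbb{R}^N$, every $M>0$ and every positive solution $u$ of (1) in $\Omega$, $$|\nabla u^a(x)|\le c\,\bigl(\operatorname{dist}(x,\partial\Omega)\bigr)^{-\frac{2a}{p-1}-1}\qquad\text{for all }x\in\Omega,$$ where for $\Omega=\mathbb{R}^N$ the distance to the (empty) boundary is $\infty$ and the right-hand side is $0$. Moreover, for every $M>0$ there is no nontrivial nonnegative solution of (1) in $\mathbb{R}^N$. -/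

import Mathlib

/-- `u` is a (classical, i.e. `C²`) solution in the open set `Ω ⊆ ℝ^N` of
`-Δ u = |u|^(p-1) u + M |∇u|^q`. Only the restriction of `u` to `Ω` matters. -/
structure IsSolutionIn {N : ℕ} (p q M : ℝ) (Ω : Set (EuclideanSpace ℝ (Fin N)))
    (u : EuclideanSpace ℝ (Fin N) → ℝ) : Prop where
  contDiffOn : ContDiffOn ℝ 2 u Ω
  equation : ∀ x ∈ Ω,
    -(Laplacian.laplacian u x) = |u x| ^ (p - 1) * u x + M * ‖gradient u x‖ ^ q

section Preliminaries

open Filter Topology InnerProductSpace Laplacian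

/-! ### Second-order calculus in coordinates, and the Laplacian at a local maximum. -/

section Calculus

variable {E : Type*} [NormedAddCommGroup E] [InnerProductSpace ℝ E] [FiniteDimensional ℝ E]
  {ι : Type*} [Fintype ι]

/-! The proof is Bernstein's method applied to `w = log u`, which satisfies `-Δw = X + U + V` with
`X = |∇w|²`, `U = e^((p-1)w)`, `V = M e^((q-1)w) |∇w|^q`. Since `M` occurs only inside `V ≥ 0`, an
estimate in terms of `X`, `U`, `V` alone is uniform in `M`.

On a ball in `Ω`, consider a positive interior maximum of `X e^(2aw)`, which is `|∇u^a|² / a²`,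
times a power of `R² - |x - x₀|²`. Bochner's formula applies there, and the Hessian is bounded below
by separating the direction of `∇w` from its complement: `|D²w|² ≥ λ² + (Δw - λ)² / (N-1)`, where
the first-order condition determines `λ`. What remains is a quadratic form in `X, U, V`, coercive
for small `a` when `(N-1)(p-1) < 4` and `(N-1)(q-1) ≤ 2` (`quadratic_form_lower_bound`); both follow
from the hypotheses on `p` and `q`. Hence `X + U` is bounded by the cutoff terms
(`estimate_of_isLocalMax`), and Young's inequality turns this into a bound for `X e^(2aw)` at the
scale dictated by `R` (`interior_gradient_estimate`).

As `u` is only `C²`, Bochner's formula is replaced by an inequality for a function touching `|∇w|²`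
from above (`bochner_of_touching_above`).

On the whole space, a nontrivial nonnegative solution is superharmonic, hence positive by the strong
minimum principle. Arbitrarily large balls then give `∇u = 0`, and the equation forces `u^p = 0`, a
contradiction. -/

theorem laplacian_eq_sum_fderiv (b : OrthonormalBasis ι ℝ E) (f : E → ℝ) (x : E) :
    Δ f x = ∑ i, fderiv ℝ (fderiv ℝ f) x (b i) (b i) := by
  rw [laplacian_eq_iteratedFDeriv_orthonormalBasis f b]
  simp [iteratedFDeriv_two_apply]

omit [FiniteDimensional ℝ E] in
theorem ContDiffAt.fderiv_two {f : E → ℝ} {x : E} (hf : ContDiffAt ℝ 2 f x) :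
    ContDiffAt ℝ 1 (fderiv ℝ f) x := hf.fderiv_right (by norm_num)

theorem ContDiffAt.continuousAt_laplacian {f : E → ℝ} {x : E} (hf : ContDiffAt ℝ 2 f x) :
    ContinuousAt (Δ f) x := by
  have h : Δ f = fun y => ∑ i, fderiv ℝ (fderiv ℝ f) y (stdOrthonormalBasis ℝ E i)
      (stdOrthonormalBasis ℝ E i) := funext fun y => laplacian_eq_sum_fderiv _ f y
  have hc : ContinuousAt (fderiv ℝ (fderiv ℝ f)) x :=
    (hf.fderiv_two.fderiv_right (m := 0) (by norm_num)).continuousAt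
  rw [h]
  fun_prop

theorem sum_sq_fderiv (b : OrthonormalBasis ι ℝ E) (f : E → ℝ) (x : E) :
    ∑ i, (fderiv ℝ f x (b i)) ^ 2 = ‖gradient f x‖ ^ 2 := by
  rw [← b.sum_sq_inner_right (gradient f x)]
  refine Finset.sum_congr rfl fun i _ => ?_
  rw [real_inner_comm, inner_gradient_left]

omit [FiniteDimensional ℝ E] in
theorem fderiv_fderiv_comp {φ : ℝ → ℝ} {f : E → ℝ} {x : E} (hφ : ContDiffAt ℝ 2 φ (f x))
    (hf : ContDiffAt ℝ 2 f x) (v : E) :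
    fderiv ℝ (fderiv ℝ (fun y => φ (f y))) x v v =
      deriv (deriv φ) (f x) * (fderiv ℝ f x v) ^ 2 +
        deriv φ (f x) * fderiv ℝ (fderiv ℝ f) x v v := by
  have e : fderiv ℝ (fun y => φ (f y)) =ᶠ[𝓝 x] fun y => deriv φ (f y) • fderiv ℝ f y := by
    filter_upwards [hf.continuousAt.eventually (hφ.eventually (by simp)),
      hf.eventually (by simp)] with y h1 h2
    exact ((h1.differentiableAt (by simp)).hasDerivAt.comp_hasFDerivAt y
      (h2.differentiableAt (by simp)).hasFDerivAt).fderiv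
  have hφ1 : DifferentiableAt ℝ (deriv φ) (f x) := by
    have h : ContDiffAt ℝ 1 (fderiv ℝ φ) (f x) := hφ.fderiv_right (by norm_num)
    have h2 : DifferentiableAt ℝ (fun s => fderiv ℝ φ s 1) (f x) :=
      (h.differentiableAt (by simp)).clm_apply (differentiableAt_const _)
    simpa only [fderiv_apply_one_eq_deriv] using h2
  have h1 := (hφ1.hasDerivAt.comp_hasFDerivAt x (hf.differentiableAt (by simp)).hasFDerivAt).smul
    (hf.fderiv_two.differentiableAt (by simp)).hasFDerivAt
  rw [e.fderiv_eq]
  have := h1.fderiv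
  simp only [Function.comp_def] at this
  erw [this]
  simp
  ring

theorem laplacian_comp {φ : ℝ → ℝ} {f : E → ℝ} {x : E} (hφ : ContDiffAt ℝ 2 φ (f x))
    (hf : ContDiffAt ℝ 2 f x) :
    Δ (fun y => φ (f y)) x =
      deriv (deriv φ) (f x) * ‖gradient f x‖ ^ 2 + deriv φ (f x) * Δ f x := by
  rw [laplacian_eq_sum_fderiv (stdOrthonormalBasis ℝ E),
    laplacian_eq_sum_fderiv (stdOrthonormalBasis ℝ E), ← sum_sq_fderiv (stdOrthonormalBasis ℝ E),
    Finset.mul_sum, Finset.mul_sum, ← Finset.sum_add_distrib]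
  exact Finset.sum_congr rfl fun i _ => fderiv_fderiv_comp hφ hf _

theorem laplacian_sq {f : E → ℝ} {x : E} (hf : ContDiffAt ℝ 2 f x) :
    Δ (fun y => f y ^ 2) x = 2 * ‖gradient f x‖ ^ 2 + 2 * f x * Δ f x := by
  rw [laplacian_comp (φ := fun s => s ^ 2) (contDiff_id.pow 2).contDiffAt hf]
  have : deriv (fun s : ℝ => s ^ 2) = fun s => 2 * s := by ext; simp
  rw [this]
  simp [deriv_const_mul_id']

theorem laplacian_sum {κ : Type*} (s : Finset κ) {f : κ → E → ℝ} {x : E}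
    (hf : ∀ i ∈ s, ContDiffAt ℝ 2 (f i) x) :
    Δ (fun y => ∑ i ∈ s, f i y) x = ∑ i ∈ s, Δ (f i) x := by
  classical
  induction s using Finset.induction_on with
  | empty => simp
  | insert i s hi ih =>
    simp only [Finset.sum_insert hi]
    rw [← ih fun j hj => hf j (Finset.mem_insert_of_mem hj)]
    exact (hf i (Finset.mem_insert_self i s)).laplacian_add
      (ContDiffAt.sum fun j hj => hf j (Finset.mem_insert_of_mem hj))

omit [FiniteDimensional ℝ E] in
theorem hasFDerivAt_norm_sub_sq (c x : E) :
    HasFDerivAt (fun y => ‖y - c‖ ^ 2) (2 • innerSL ℝ (x - c)) x := by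
  simpa using ((hasFDerivAt_id x).sub_const c).norm_sq

omit [FiniteDimensional ℝ E] in
theorem contDiff_norm_sub_sq (c : E) : ContDiff ℝ 2 fun y : E => ‖y - c‖ ^ 2 :=
  (contDiff_id.sub contDiff_const).norm_sq ℝ

theorem gradient_norm_sub_sq (c x : E) : gradient (fun y => ‖y - c‖ ^ 2) x = (2 : ℝ) • (x - c) := by
  refine ext_inner_right ℝ fun v => ?_
  rw [inner_gradient_left, (hasFDerivAt_norm_sub_sq c x).fderiv]
  simp [inner_smul_left, inner_sub_left]

theorem laplacian_norm_sub_sq (c x : E) :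
    Δ (fun y => ‖y - c‖ ^ 2) x = 2 * Module.finrank ℝ E := by
  have h : fderiv ℝ (fun y : E => ‖y - c‖ ^ 2) = fun y => (2 • innerSL ℝ : E →L[ℝ] E →L[ℝ] ℝ) (y - c) :=
    funext fun y => by rw [(hasFDerivAt_norm_sub_sq c y).fderiv]; rfl
  have h2 : HasFDerivAt (fun y => (2 • innerSL ℝ : E →L[ℝ] E →L[ℝ] ℝ) (y - c))
      (2 • innerSL ℝ : E →L[ℝ] E →L[ℝ] ℝ) x := by
    have := (2 • innerSL ℝ : E →L[ℝ] E →L[ℝ] ℝ).hasFDerivAt.comp x ((hasFDerivAt_id x).sub_const c)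
    exact this
  rw [laplacian_eq_sum_fderiv (stdOrthonormalBasis ℝ E), h, h2.fderiv]
  have key (i) : (2 • innerSL ℝ : E →L[ℝ] E →L[ℝ] ℝ) (stdOrthonormalBasis ℝ E i)
      (stdOrthonormalBasis ℝ E i) = 2 := by
    change 2 • inner ℝ (stdOrthonormalBasis ℝ E i) (stdOrthonormalBasis ℝ E i) = 2
    simp
  rw [Finset.sum_congr rfl fun i _ => key i]
  simp [mul_comm]

/-- A positive second derivative would make `t` a local minimum as well, so `h` would be locally
constant and its second derivative zero. -/
theorem deriv_deriv_nonpos_of_isLocalMax {h : ℝ → ℝ} {t : ℝ} (hm : IsLocalMax h t)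
    (hc : ContinuousAt h t) : deriv (deriv h) t ≤ 0 := by
  by_contra! hpos
  have hmin := isLocalMin_of_deriv_deriv_pos hpos hm.deriv_eq_zero hc
  have he : h =ᶠ[𝓝 t] fun _ => h t := by
    filter_upwards [hm, hmin] with s h1 h2 using le_antisymm h1 h2
  have := he.deriv.deriv_eq
  simp at this
  simp [this] at hpos

omit [FiniteDimensional ℝ E] in
theorem fderiv_fderiv_apply_eq_deriv_deriv {f : E → ℝ} {x : E} (hf : ContDiffAt ℝ 2 f x) (v : E) :
    fderiv ℝ (fderiv ℝ f) x v v = deriv (deriv fun t : ℝ => f (x + t • v)) 0 := by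
  have hl (t : ℝ) : HasDerivAt (fun t : ℝ => x + t • v) v t := by
    have h := ((hasDerivAt_id t).smul_const v).const_add x
    rwa [one_smul] at h
  have hl0 : Tendsto (fun t : ℝ => x + t • v) (𝓝 0) (𝓝 x) := by
    have h := (hl 0).continuousAt.tendsto
    rwa [zero_smul, add_zero] at h
  have e : deriv (fun t : ℝ => f (x + t • v)) =ᶠ[𝓝 0] fun t => fderiv ℝ f (x + t • v) v := by
    filter_upwards [hl0.eventually (hf.eventually (by simp))] with t ht
    exact ((ht.differentiableAt (by simp)).hasFDerivAt.comp_hasDerivAt t (hl t)).deriv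
  have h1 : HasFDerivAt (fun y => fderiv ℝ f y v) ((fderiv ℝ (fderiv ℝ f) x).flip v)
      (x + (0 : ℝ) • v) := by
    rw [zero_smul, add_zero]
    have h := (hf.fderiv_two.differentiableAt (by simp)).hasFDerivAt.clm_apply
      (hasFDerivAt_const v x)
    refine h.congr_fderiv ?_
    ext z
    simp
  have h2 : HasDerivAt (fun t : ℝ => fderiv ℝ f (x + t • v) v)
    ((fderiv ℝ (fderiv ℝ f) x).flip v v) 0 :=
    HasFDerivAt.comp_hasDerivAt (l := fun y => fderiv ℝ f y v) (0 : ℝ) h1 (hl 0)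
  rw [e.deriv_eq, h2.deriv, ContinuousLinearMap.flip_apply]

theorem laplacian_nonpos_of_isLocalMax {f : E → ℝ} {x : E} (hm : IsLocalMax f x)
    (hf : ContDiffAt ℝ 2 f x) : Δ f x ≤ 0 := by
  rw [laplacian_eq_sum_fderiv (stdOrthonormalBasis ℝ E)]
  refine Finset.sum_nonpos fun i _ => ?_
  set v := stdOrthonormalBasis ℝ E i
  rw [fderiv_fderiv_apply_eq_deriv_deriv hf]
  have hl0 : ContinuousAt (fun t : ℝ => x + t • v) 0 := by fun_prop
  have hx : x + (0 : ℝ) • v = x := by simp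
  refine deriv_deriv_nonpos_of_isLocalMax ?_ ?_
  · have := hl0.tendsto
    rw [hx] at this
    filter_upwards [this.eventually hm] with t ht
    simpa using ht
  · refine ContinuousAt.comp (g := f) ?_ hl0
    rw [hx]
    exact hf.continuousAt

/-- Strict differentiability allows the base point of the difference quotient to move with the step;
below, the base points are maximum points depending on the step. -/
theorem HasStrictFDerivAt.tendsto_smul_sub {F G : Type*} [NormedAddCommGroup F] [NormedSpace ℝ F]
    [NormedAddCommGroup G] [NormedSpace ℝ G] {f : F → G}
    {f' : F →L[ℝ] G} {y : F} (hf : HasStrictFDerivAt f f' y) (v : F) {α : Type*} {l : Filter α}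
    {t : α → ℝ} {x : α → F} (ht : Tendsto t l (𝓝 0)) (ht0 : ∀ n, t n ≠ 0)
    (hx : Tendsto x l (𝓝 y)) :
    Tendsto (fun n => (t n)⁻¹ • (f (x n + t n • v) - f (x n))) l (𝓝 (f' v)) := by
  have h1 : Tendsto (fun n => (x n + t n • v, x n)) l (𝓝 (y, y)) := by
    have : Tendsto (fun n => x n + t n • v) l (𝓝 (y + (0 : ℝ) • v)) := hx.add (ht.smul_const v)
    simp only [zero_smul, add_zero] at this
    exact this.prodMk_nhds hx
  have h2 := hf.isLittleO.comp_tendsto h1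
  have h3 : (fun n => f (x n + t n • v) - f (x n) - f' (t n • v)) =o[l] t := by
    refine Asymptotics.IsLittleO.trans_isBigO (by simpa [Function.comp_def] using h2) ?_
    refine Asymptotics.IsBigO.of_bound ‖v‖ (Eventually.of_forall fun n => ?_)
    rw [norm_smul, mul_comm]
  have h4 := h3.tendsto_inv_smul_nhds_zero
  have h5 : Tendsto (fun n => (t n)⁻¹ • (f (x n + t n • v) - f (x n) - f' (t n • v)) + f' v) l
      (𝓝 (0 + f' v)) := h4.add_const _
  rw [zero_add] at h5
  refine h5.congr fun n => ?_
  rw [smul_sub, map_smul, inv_smul_smul₀ (ht0 n)]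
  abel

end Calculus

/-! ### A Bochner inequality without third derivatives. -/

section Bochner

variable {E : Type*} [NormedAddCommGroup E] [InnerProductSpace ℝ E] [FiniteDimensional ℝ E]
  {ι : Type*} [Fintype ι]

omit [FiniteDimensional ℝ E] in
theorem contDiffAt_differenceQuotient {w : E → ℝ} {x : E} (t : ℝ) (v : E)
    (hw : ContDiffAt ℝ 2 w x) (hw' : ContDiffAt ℝ 2 w (x + t • v)) :
    ContDiffAt ℝ 2 (fun z => t⁻¹ * (w (z + t • v) - w z)) x :=
  contDiffAt_const.mul ((ContDiffAt.comp x (f := fun z => z + t • v) hw'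
    (contDiffAt_id.add contDiffAt_const)).sub hw)

omit [FiniteDimensional ℝ E] in
theorem fderiv_differenceQuotient {w : E → ℝ} {x : E} (t : ℝ) (v : E)
    (hw : ContDiffAt ℝ 2 w x) (hw' : ContDiffAt ℝ 2 w (x + t • v)) :
    fderiv ℝ (fun z => t⁻¹ * (w (z + t • v) - w z)) x =
      t⁻¹ • (fderiv ℝ w (x + t • v) - fderiv ℝ w x) := by
  have h1 : HasFDerivAt (fun z => w (z + t • v)) (fderiv ℝ w (x + t • v)) x :=
    (hasFDerivAt_comp_add_right (t • v)).2 (hw'.differentiableAt (by simp)).hasFDerivAt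
  exact ((h1.sub (hw.differentiableAt (by simp)).hasFDerivAt).const_mul t⁻¹).fderiv

theorem laplacian_comp_add_right (w : E → ℝ) (a x : E) :
    Δ (fun z => w (z + a)) x = Δ w (x + a) := by
  have h : fderiv ℝ (fun z => w (z + a)) = fun z => fderiv ℝ w (z + a) :=
    funext fun z => fderiv_comp_add_right a
  rw [laplacian_eq_sum_fderiv (stdOrthonormalBasis ℝ E),
    laplacian_eq_sum_fderiv (stdOrthonormalBasis ℝ E), h]
  simp only [fderiv_comp_add_right]

theorem laplacian_differenceQuotient {w : E → ℝ} {x : E} (t : ℝ) (v : E)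
    (hw : ContDiffAt ℝ 2 w x) (hw' : ContDiffAt ℝ 2 w (x + t • v)) :
    Δ (fun z => t⁻¹ * (w (z + t • v) - w z)) x = t⁻¹ * (Δ w (x + t • v) - Δ w x) := by
  have h1 : ContDiffAt ℝ 2 (fun z => w (z + t • v)) x :=
    ContDiffAt.comp x (f := fun z => z + t • v) hw' (contDiffAt_id.add contDiffAt_const)
  have h2 := laplacian_smul t⁻¹ (h1.sub hw)
  have h3 := h1.laplacian_sub hw
  rw [laplacian_comp_add_right] at h3
  rw [← h3]
  exact h2

/-- The inequality `2 |D²w|² + 2 ⟪∇g, ∇w⟫ ≤ Δ Θ` at a point where the `C²` function `Θ` touches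
`|∇w|²` from above, for a `C²` function `w` with `Δ w = g` of class `C¹`. No third derivatives of
`w` are needed: `∂ᵢ w` is replaced by difference quotients. -/
theorem bochner_of_touching_above (b : OrthonormalBasis ι ℝ E) {w g Θ : E → ℝ} {y : E}
    (hw : ContDiffAt ℝ 2 w y) (hg : ContDiffAt ℝ 1 g y) (hΘ : ContDiffAt ℝ 2 Θ y)
    (hlap : ∀ᶠ x in 𝓝 y, Δ w x = g x)
    (hle : ∀ᶠ x in 𝓝 y, ∑ i, (fderiv ℝ w x (b i)) ^ 2 ≤ Θ x)
    (heq : ∑ i, (fderiv ℝ w y (b i)) ^ 2 = Θ y) :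
    2 * ∑ i, ∑ j, (fderiv ℝ (fderiv ℝ w) y (b i) (b j)) ^ 2 +
      2 * ∑ i, fderiv ℝ w y (b i) * fderiv ℝ g y (b i) ≤ Δ Θ y := by
  obtain ⟨r, hr, hball⟩ : ∃ r > 0, ∀ x, dist x y < 2 * r →
      ContDiffAt ℝ 2 w x ∧ ContDiffAt ℝ 2 Θ x ∧ Δ w x = g x ∧
        ∑ i, (fderiv ℝ w x (b i)) ^ 2 ≤ Θ x := by
    obtain ⟨r, hr, h⟩ := Metric.eventually_nhds_iff.1 ((hw.eventually (by simp)).and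
      ((hΘ.eventually (by simp)).and (hlap.and hle)))
    exact ⟨r / 2, by positivity, fun x hx => h (by linarith)⟩
  -- The `+ 2` makes every step strictly smaller than `r`, so a shifted point of the closed `r`-ball
  -- stays in the open `2r`-ball.
  set t : ℕ → ℝ := fun n => r / (n + 2) with ht_def
  have ht0 (n) : 0 < t n := by positivity
  have htr (n) : t n < r := by
    rw [ht_def]
    refine div_lt_self hr ?_
    have : (0 : ℝ) ≤ n := n.cast_nonneg
    linarith
  have htlim : Tendsto t atTop (𝓝 0) :=
    tendsto_const_nhds.div_atTop (tendsto_atTop_add_const_right _ _ tendsto_natCast_atTop_atTop)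
  set D : ℕ → ι → E → ℝ := fun n i x => (t n)⁻¹ * (w (x + t n • b i) - w x) with hD
  have hshift (n i) {x : E} (hx : dist x y ≤ r) : dist (x + t n • b i) y < 2 * r := by
    calc dist (x + t n • b i) y ≤ dist (x + t n • b i) x + dist x y := dist_triangle _ _ _
      _ < 2 * r := by
        rw [dist_eq_norm, add_sub_cancel_left, norm_smul, b.norm_eq_one, Real.norm_eq_abs,
          abs_of_pos (ht0 n)]
        linarith [htr n]
  have hx2 {x : E} (hx : dist x y ≤ r) : dist x y < 2 * r := by linarith
  have hDC (n i) {x : E} (hx : dist x y ≤ r) : ContDiffAt ℝ 2 (D n i) x :=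
    contDiffAt_differenceQuotient _ _ (hball x (hx2 hx)).1 (hball _ (hshift n i hx)).1
  have hw1 (x) (hx : dist x y ≤ r) : HasStrictFDerivAt w (fderiv ℝ w x) x :=
    (hball x (hx2 hx)).1.hasStrictFDerivAt (by simp)
  have key (δ : ℝ) (hδ : 0 < δ) :
      2 * ∑ i, ∑ j, (fderiv ℝ (fderiv ℝ w) y (b i) (b j)) ^ 2 +
        2 * ∑ i, fderiv ℝ w y (b i) * fderiv ℝ g y (b i) - Δ Θ y -
          δ * (2 * Module.finrank ℝ E) ≤ 0 := by
    -- The penalty makes `y` the unique maximum of the limiting function, so maximum points of `f n`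
    -- accumulate only at `y`. There `Δ (f n) ≤ 0` involves only second derivatives of `w` and
    -- difference quotients, and passes to the limit; finally `δ → 0`.
    set f : ℕ → E → ℝ := fun n x => ∑ i, D n i x ^ 2 - Θ x - δ * ‖x - y‖ ^ 2 with hf
    have hsumC (n) {x : E} (hx : dist x y ≤ r) : ContDiffAt ℝ 2 (fun x => ∑ i, D n i x ^ 2) x :=
      ContDiffAt.sum fun i _ => (hDC n i hx).pow 2
    have hqC (x : E) : ContDiffAt ℝ 2 (fun x => ‖x - y‖ ^ 2) x :=
      (contDiff_norm_sub_sq y).contDiffAt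
    have hfC (n) {x : E} (hx : dist x y ≤ r) : ContDiffAt ℝ 2 (f n) x :=
      ((hsumC n hx).sub (hball x (hx2 hx)).2.1).sub (contDiffAt_const.mul (hqC x))
    have hmax (n) : ∃ x ∈ Metric.closedBall y r, IsMaxOn (f n) (Metric.closedBall y r) x :=
      (isCompact_closedBall y r).exists_isMaxOn ⟨y, Metric.mem_closedBall_self hr.le⟩
        fun x hx => (hfC n hx).continuousAt.continuousWithinAt
    choose x hxmem hxmax using hmax
    obtain ⟨z, hz, φ, hφ, hxz⟩ := (isCompact_closedBall y r).tendsto_subseq hxmem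
    have htφ : Tendsto (fun n => t (φ n)) atTop (𝓝 0) := htlim.comp hφ.tendsto_atTop
    have hDz (i) : Tendsto (fun n => D (φ n) i (x (φ n))) atTop (𝓝 (fderiv ℝ w z (b i))) :=
      (hw1 z hz).tendsto_smul_sub (b i) htφ (fun n => (ht0 _).ne') hxz
    have hDy (i) : Tendsto (fun n => D (φ n) i y) atTop (𝓝 (fderiv ℝ w y (b i))) :=
      (hw1 y (by simpa using hr.le)).tendsto_smul_sub (b i) htφ (fun n => (ht0 _).ne')
        tendsto_const_nhds
    have hzy : z = y := by
      have h1 : Tendsto (fun n => f (φ n) y) atTop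
          (𝓝 (∑ i, (fderiv ℝ w y (b i)) ^ 2 - Θ y - δ * ‖y - y‖ ^ 2)) :=
        ((tendsto_finsetSum _ fun i _ => (hDy i).pow 2).sub_const _).sub_const _
      have h2 : Tendsto (fun n => f (φ n) (x (φ n))) atTop
          (𝓝 (∑ i, (fderiv ℝ w z (b i)) ^ 2 - Θ z - δ * ‖z - y‖ ^ 2)) :=
        ((tendsto_finsetSum _ fun i _ => (hDz i).pow 2).sub
          ((hball z (hx2 hz)).2.1.continuousAt.tendsto.comp hxz)).sub
          ((hqC z).continuousAt.tendsto.comp hxz |>.const_mul δ)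
      have h3 := le_of_tendsto_of_tendsto' h1 h2 fun n =>
        hxmax (φ n) (Metric.mem_closedBall_self hr.le)
      rw [heq, sub_self, sub_self, norm_zero] at h3
      have h4 := (hball z (hx2 hz)).2.2.2
      have h5 : ‖z - y‖ ^ 2 ≤ 0 := by
        by_contra! h
        nlinarith [mul_pos hδ h]
      simpa [sub_eq_zero] using h5
    subst hzy
    have hev : ∀ᶠ n in atTop, dist (x (φ n)) z < r :=
      hxz.eventually (Metric.ball_mem_nhds z hr)
    have hg1 : HasStrictFDerivAt g (fderiv ℝ g z) z := hg.hasStrictFDerivAt (by simp)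
    have hw2 : HasStrictFDerivAt (fderiv ℝ w) (fderiv ℝ (fderiv ℝ w) z) z :=
      hw.fderiv_two.hasStrictFDerivAt (by simp)
    have hlim : Tendsto (fun n => ∑ i, (2 * ∑ j, ((t (φ n))⁻¹ • (fderiv ℝ w (x (φ n) +
        t (φ n) • b i) - fderiv ℝ w (x (φ n)))) (b j) ^ 2 + 2 * D (φ n) i (x (φ n)) *
        ((t (φ n))⁻¹ • (g (x (φ n) + t (φ n) • b i) - g (x (φ n))))) - Δ Θ (x (φ n)) -
          δ * (2 * Module.finrank ℝ E)) atTop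
        (𝓝 (∑ i, (2 * ∑ j, (fderiv ℝ (fderiv ℝ w) z (b i) (b j)) ^ 2 +
          2 * fderiv ℝ w z (b i) * fderiv ℝ g z (b i)) - Δ Θ z -
          δ * (2 * Module.finrank ℝ E))) := by
      refine Tendsto.sub_const (Tendsto.sub (tendsto_finsetSum _ fun i _ => Tendsto.add
        (Tendsto.const_mul _ (tendsto_finsetSum _ fun j _ => Tendsto.pow ?_ 2))
        (((hDz i).const_mul 2).mul
          (hg1.tendsto_smul_sub (b i) htφ (fun n => (ht0 _).ne') hxz)))
        (hΘ.continuousAt_laplacian.tendsto.comp hxz)) _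
      exact ((ContinuousLinearMap.apply ℝ ℝ (b j)).continuous.tendsto _).comp
        (hw2.tendsto_smul_sub (b i) htφ (fun n => (ht0 _).ne') hxz)
    have hnonpos := le_of_tendsto hlim (b := 0) (by
      filter_upwards [hev] with n hn
      have hloc : IsLocalMax (f (φ n)) (x (φ n)) :=
        (hxmax (φ n)).isLocalMax (Metric.closedBall_mem_nhds_of_mem hn)
      refine le_of_eq_of_le ?_ (laplacian_nonpos_of_isLocalMax hloc (hfC (φ n) hn.le))
      have hx' := hn.le
      generalize x (φ n) = X at hx'
      generalize φ n = m
      have e1 := ((hsumC m hx').sub (hball X (hx2 hx')).2.1).laplacian_sub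
        (contDiffAt_const (c := δ) |>.mul (hqC X))
      have e2 : Δ (fun x => ∑ i, D m i x ^ 2 - Θ x) X =
          Δ (fun x => ∑ i, D m i x ^ 2) X - Δ Θ X := (hsumC m hx').laplacian_sub (hball X (hx2 hx')).2.1
      have e3 : Δ (fun x => δ * ‖x - z‖ ^ 2) X = δ * Δ (fun x => ‖x - z‖ ^ 2) X :=
        laplacian_smul δ (hqC X)
      have e4 := laplacian_sum Finset.univ fun i _ => (hDC m i hx').pow 2
      rw [laplacian_norm_sub_sq] at e3
      rw [e3, e2, e4] at e1
      refine Eq.trans ?_ e1.symm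
      congr 2
      refine Finset.sum_congr rfl fun i _ => ?_
      have hX := (hball X (hx2 hx'))
      have hX' := (hball _ (hshift m i hx'))
      rw [laplacian_sq (hDC m i hx'), ← sum_sq_fderiv b,
        fderiv_differenceQuotient _ _ hX.1 hX'.1,
        laplacian_differenceQuotient _ _ hX.1 hX'.1, hX.2.2.1, hX'.2.2.1]
      rfl)
    refine le_of_eq_of_le ?_ hnonpos
    rw [Finset.sum_add_distrib, Finset.mul_sum, Finset.mul_sum]
    simp only [mul_assoc]
  refine le_of_forall_pos_le_add fun ε hε => ?_
  have h := key (ε / (2 * Module.finrank ℝ E + 1)) (by positivity)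
  have : ε / (2 * Module.finrank ℝ E + 1) * (2 * Module.finrank ℝ E) ≤ ε := by
    rw [div_mul_eq_mul_div, div_le_iff₀ (by positivity)]
    nlinarith
  linarith

end Bochner

/-! ### The algebraic inequality and the estimate at a maximum point. -/

section PointwiseEstimate

/-- For `a = σ = 0` the form is `(X+U+V)²/m - (p-1)UX - (q-1)VX`, coercive on nonnegative `X, U, V`:
the `UX` coefficient exceeds `-2/m` and the `VX` coefficient is nonnegative. Small `a` and Young's
inequality absorb the rest. In the application `t` is the second derivative of `w` along `∇w`, `σ =
⟪∇w, ∇T⟫`, and `t = σ/2 - aX` is the first-order condition. -/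
theorem quadratic_form_lower_bound {m p q : ℝ} (hm : 0 < m) (hp : m * (p - 1) < 4)
    (hq : m * (q - 1) ≤ 2) (hq0 : 0 ≤ q) :
    ∃ a c C : ℝ, 0 < a ∧ 0 < c ∧ 0 ≤ C ∧ ∀ X U V σ t : ℝ, 0 ≤ X → 0 ≤ U → 0 ≤ V →
      t = σ / 2 - a * X →
      c * (X ^ 2 + U ^ 2 + V ^ 2) - C * σ ^ 2 ≤
        (X + U + V + t) ^ 2 / m + t ^ 2 - 2 * t * X - q * V * t - (p - 1) * U * X
          - (q - 1) * V * X + 4 * a * t * X + 2 * a ^ 2 * X ^ 2 - a * (X + U + V) * X := by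
  -- `d` measures the room left in `m (p - 1) < 4`; it becomes the coercivity constant `c₀ = d / m`.
  obtain ⟨d, hd0, hd1, hd⟩ : ∃ d : ℝ, 0 < d ∧ d ≤ 1 ∧ m * (p - 1) - 2 ≤ 2 - 2 * d :=
    ⟨min 1 ((4 - m * (p - 1)) / 2), lt_min one_pos (by linarith), min_le_left _ _, by
      linarith [min_le_right 1 ((4 - m * (p - 1)) / 2)]⟩
  set c₀ := d / m with hc₀
  have hc₀pos : 0 < c₀ := by positivity
  set K := 2 / m + q + 6 with hK
  have hKpos : 0 < K := by positivity
  -- With `S² ≤ 3n`, the terms of order `a` cost at most `c₀ n / 2` and the Young step `h3` costs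
  -- `c₀ n / 4`, leaving `c₀ / 4`.
  obtain ⟨a, ha0, ha1, ha⟩ : ∃ a : ℝ, 0 < a ∧ a ≤ 1 ∧ (K + 1) * a ≤ c₀ / 6 :=
    ⟨min 1 (c₀ / 6 / (K + 1)), lt_min one_pos (by positivity), min_le_left _ _, by
      rw [mul_comm, ← le_div_iff₀ (by positivity)]
      exact min_le_right _ _⟩
  refine ⟨a, c₀ / 4, 3 * K ^ 2 / (4 * c₀), ha0, by positivity, by positivity, ?_⟩
  intro X U V σ t hX hU hV ht
  set S := X + U + V with hS
  set n := X ^ 2 + U ^ 2 + V ^ 2 with hn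
  have hS0 : 0 ≤ S := by positivity
  have hXS : X ≤ S := by linarith
  have hVS : V ≤ S := by linarith
  have hSn : S ^ 2 ≤ 3 * n := by
    nlinarith [sq_nonneg (X - U), sq_nonneg (X - V), sq_nonneg (U - V)]
  have h0 : c₀ * n ≤ S ^ 2 / m - (p - 1) * U * X - (q - 1) * V * X := by
    have h1 : d * n ≤ S ^ 2 - m * (p - 1) * (U * X) - m * (q - 1) * (V * X) := by
      have e1 := mul_nonneg hU hX
      have e2 := mul_nonneg hV hX
      have e3 := mul_nonneg hU hV
      have e4 := mul_le_mul_of_nonneg_right hd e1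
      have e5 := mul_le_mul_of_nonneg_right hq e2
      have e6 := mul_nonneg (sub_nonneg.2 hd1) (sq_nonneg (X - U))
      have e7 := mul_nonneg (sub_nonneg.2 hd1) (sq_nonneg V)
      simp only [hn, hS]
      nlinarith
    have h2 : c₀ * n = d * n / m := by rw [hc₀]; ring
    have h3 : S ^ 2 / m - (p - 1) * U * X - (q - 1) * V * X =
        (S ^ 2 - m * (p - 1) * (U * X) - m * (q - 1) * (V * X)) / m := by
      field_simp
    rw [h2, h3]
    gcongr
  have htabs : |t| ≤ |σ| / 2 + a * S := by
    rw [ht]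
    calc |σ / 2 - a * X| ≤ |σ / 2| + |a * X| := abs_sub _ _
      _ = |σ| / 2 + a * X := by rw [abs_div, abs_mul, abs_of_pos ha0, abs_of_nonneg hX]; norm_num
      _ ≤ _ := by gcongr
  have h1 : -(K * (|t| * S)) - a * S ^ 2 ≤ 2 * S * t / m + t ^ 2 / m + t ^ 2 - 2 * t * X
      - q * V * t + 4 * a * t * X + 2 * a ^ 2 * X ^ 2 - a * S * X := by
    have i1 : -(2 / m * (|t| * S)) ≤ 2 * S * t / m := by
      have : 2 * S * t / m = 2 / m * (t * S) := by ring
      rw [this, ← mul_neg, ← neg_mul]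
      gcongr
      exact neg_abs_le t
    have i2 : |t| * X ≤ |t| * S := by gcongr
    have i3 : t * X ≤ |t| * X := by gcongr; exact le_abs_self t
    have i4 : q * V * t ≤ q * (|t| * S) := by
      rw [mul_assoc, mul_comm V t]
      gcongr
      exact le_abs_self t
    have i5 : -(4 * (|t| * S)) ≤ 4 * a * t * X := by
      have j1 : -(|t| * S) ≤ a * (t * X) := by
        have j2 : a * (|t| * X) ≤ 1 * (|t| * S) := by gcongr
        have j3 : a * (-|t| * X) ≤ a * (t * X) := by gcongr; exact neg_abs_le t
        linarith
      linarith
    have i6 : a * S * X ≤ a * S ^ 2 := by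
      rw [mul_assoc, sq]
      gcongr
    have i7 : 0 ≤ t ^ 2 / m := by positivity
    have i8 : 0 ≤ 2 * a ^ 2 * X ^ 2 := by positivity
    have i9 : K * (|t| * S) = 2 / m * (|t| * S) + q * (|t| * S) + 6 * (|t| * S) := by
      rw [hK]; ring
    linarith [sq_nonneg t]
  have h2 : K * (|t| * S) ≤ K * (|σ| * S / 2) + K * a * S ^ 2 := by
    have : |t| * S ≤ (|σ| / 2 + a * S) * S := by gcongr
    calc K * (|t| * S) ≤ K * ((|σ| / 2 + a * S) * S) := by gcongr
      _ = _ := by ring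
  have h3 : K * (|σ| * S / 2) ≤ c₀ / 12 * S ^ 2 + 3 * K ^ 2 / (4 * c₀) * σ ^ 2 := by
    have e : c₀ / 12 * S ^ 2 + 3 * K ^ 2 / (4 * c₀) * σ ^ 2 - K * (|σ| * S / 2) =
        (c₀ * S - 3 * K * |σ|) ^ 2 / (12 * c₀) := by
      rw [← sq_abs σ]
      field_simp
      ring
    have : 0 ≤ (c₀ * S - 3 * K * |σ|) ^ 2 / (12 * c₀) := by positivity
    linarith
  have h4 : (K + 1) * a * S ^ 2 ≤ c₀ / 6 * S ^ 2 := by gcongr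
  have h5 := mul_le_mul_of_nonneg_left hSn hc₀pos.le
  have h6 : (S + t) ^ 2 / m = S ^ 2 / m + 2 * S * t / m + t ^ 2 / m := by ring
  rw [h6]
  linarith

variable {E : Type*} [NormedAddCommGroup E] [InnerProductSpace ℝ E] [FiniteDimensional ℝ E]
  {ι : Type*} [Fintype ι]

theorem exists_orthonormalBasis_extending {N : ℕ} (hN : Module.finrank ℝ E = N) (i₀ : Fin N)
    {e : E} (he : ‖e‖ = 1) : ∃ b : OrthonormalBasis (Fin N) ℝ E, b i₀ = e := by
  have h : Orthonormal ℝ (Set.domRestrict {i₀} fun _ : Fin N => e) := by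
    refine ⟨fun _ => he, fun i j hij => ?_⟩
    exact absurd (Subsingleton.elim i j) hij
  obtain ⟨b, hb⟩ := h.exists_orthonormalBasis_extension_of_card_eq (by simpa using hN)
  exact ⟨b, hb i₀ rfl⟩

/-- Off-diagonal entries are dropped and Cauchy–Schwarz is applied to the other `N - 1` diagonal
entries. Isolating `i₀` gives the factor `N - 1` where the plain trace inequality gives `N`. -/
theorem sq_trace_sub_le_sum_sq {N : ℕ} (i₀ : Fin N) (A : Fin N → Fin N → ℝ) :
    (A i₀ i₀) ^ 2 * ((N : ℝ) - 1) + (∑ i, A i i - A i₀ i₀) ^ 2 ≤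
      ((N : ℝ) - 1) * ∑ i, ∑ j, A i j ^ 2 := by
  have hN : 0 < N := i₀.pos
  have hcard : (((Finset.univ.erase i₀ : Finset (Fin N)).card : ℕ) : ℝ) = (N : ℝ) - 1 := by
    rw [Finset.card_erase_of_mem (Finset.mem_univ _), Finset.card_univ, Fintype.card_fin,
      Nat.cast_sub hN, Nat.cast_one]
  have h1 : ∑ i, A i i - A i₀ i₀ = ∑ i ∈ Finset.univ.erase i₀, A i i := by
    rw [← Finset.add_sum_erase _ _ (Finset.mem_univ i₀)]; ring
  have h2 := sq_sum_le_card_mul_sum_sq (s := Finset.univ.erase i₀) (f := fun i => A i i)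
  rw [hcard] at h2
  have h3 : A i₀ i₀ ^ 2 + ∑ i ∈ Finset.univ.erase i₀, A i i ^ 2 ≤ ∑ i, ∑ j, A i j ^ 2 := by
    rw [Finset.add_sum_erase _ (fun i => A i i ^ 2) (Finset.mem_univ i₀)]
    exact Finset.sum_le_sum fun i _ =>
      Finset.single_le_sum (f := fun j => A i j ^ 2) (fun j _ => sq_nonneg _) (Finset.mem_univ i)
  have h4 : (0 : ℝ) ≤ (N : ℝ) - 1 := by
    have : (1 : ℝ) ≤ N := by exact_mod_cast hN
    linarith
  rw [h1]
  nlinarith [mul_le_mul_of_nonneg_left h3 h4]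

theorem contDiffAt_norm_gradient_sq {w : E → ℝ} {y : E} (hw : ContDiffAt ℝ 2 w y) :
    ContDiffAt ℝ 1 (fun x => ‖gradient w x‖ ^ 2) y := by
  simp only [← sum_sq_fderiv (stdOrthonormalBasis ℝ E)]
  exact ContDiffAt.sum fun i _ => (hw.fderiv_two.clm_apply contDiffAt_const).pow 2

set_option maxHeartbeats 800000 in
/-- The pointwise estimate at a maximum of `|∇w|² exp (2 a w - T)`, for `w = log u`. -/
theorem estimate_of_isLocalMax {N : ℕ} (hfin : Module.finrank ℝ E = N) (hN : 2 ≤ N)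
    {p q M a c C : ℝ} (hM : 0 ≤ M) (hC : 0 ≤ C)
    (hform : ∀ X U V σ t : ℝ, 0 ≤ X → 0 ≤ U → 0 ≤ V → t = σ / 2 - a * X →
      c * (X ^ 2 + U ^ 2 + V ^ 2) - C * σ ^ 2 ≤
        (X + U + V + t) ^ 2 / ((N : ℝ) - 1) + t ^ 2 - 2 * t * X - q * V * t - (p - 1) * U * X
          - (q - 1) * V * X + 4 * a * t * X + 2 * a ^ 2 * X ^ 2 - a * (X + U + V) * X)
    (hc : 0 < c) {w T : E → ℝ} {y : E} (hw : ContDiffAt ℝ 2 w y) (hT : ContDiffAt ℝ 2 T y)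
    (heq : ∀ᶠ x in 𝓝 y, -Δ w x = ‖gradient w x‖ ^ 2 + Real.exp ((p - 1) * w x) +
      M * Real.exp ((q - 1) * w x) * (‖gradient w x‖ ^ 2) ^ (q / 2))
    (hmax : IsLocalMax (fun x => ‖gradient w x‖ ^ 2 * Real.exp (2 * a * w x - T x)) y)
    (hy : gradient w y ≠ 0) :
    c * (‖gradient w y‖ ^ 2 + Real.exp ((p - 1) * w y)) ≤
      (1 + 2 * C) * ‖gradient T y‖ ^ 2 + Δ T y := by
  have hG : 0 < ‖gradient w y‖ := norm_pos_iff.2 hy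
  set G := ‖gradient w y‖ with hGdef
  obtain ⟨b, hb⟩ := exists_orthonormalBasis_extending hfin (⟨0, by omega⟩ : Fin N)
    (e := G⁻¹ • gradient w y) (by rw [norm_smul, norm_inv, norm_norm, inv_mul_cancel₀ hG.ne'])
  set i₀ : Fin N := ⟨0, by omega⟩
  -- In a frame adapted to `∇w`, every sum against `∇w` reduces to its `i₀` term.
  have hgrad : gradient w y = G • b i₀ := by rw [hb, smul_inv_smul₀ hG.ne']
  have hwi (i) : fderiv ℝ w y (b i) = if i = i₀ then G else 0 := by
    rw [← inner_gradient_left, hgrad, inner_smul_left, b.inner_eq_ite]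
    simp [eq_comm]
  have hsingle (f : Fin N → ℝ) : ∑ i, fderiv ℝ w y (b i) * f i = G * f i₀ := by
    simp [hwi]
  -- the touching function
  set Q := G ^ 2 * Real.exp (2 * a * w y - T y) with hQ
  set S : E → ℝ := fun x => T x - 2 * a * w x with hS
  set Θ : E → ℝ := fun x => Q * Real.exp (S x) with hΘ
  have hSC : ContDiffAt ℝ 2 S y := hT.sub (contDiffAt_const.mul hw)
  have hΘy : Θ y = G ^ 2 := by
    simp only [hΘ, hQ, hS]
    rw [mul_assoc, ← Real.exp_add]
    simp
  have hφ : ContDiff ℝ 2 fun s => Q * Real.exp s := contDiff_const.mul Real.contDiff_exp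
  have hΘC : ContDiffAt ℝ 2 Θ y := hφ.contDiffAt.comp y hSC
  have hle : ∀ᶠ x in 𝓝 y, ∑ i, (fderiv ℝ w x (b i)) ^ 2 ≤ Θ x := by
    filter_upwards [hmax] with x hx
    rw [sum_sq_fderiv]
    have h1 : 2 * a * w x - T x = -S x := by simp only [hS]; ring
    rw [h1, Real.exp_neg, ← div_eq_mul_inv, div_le_iff₀ (Real.exp_pos _)] at hx
    exact hx
  have hΘeq : ∑ i, (fderiv ℝ w y (b i)) ^ 2 = Θ y := by rw [sum_sq_fderiv, hΘy]
  -- first order condition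
  have hXd : HasFDerivAt (fun x => ‖gradient w x‖ ^ 2) (fderiv ℝ Θ y) y := by
    have hd := ((contDiffAt_norm_gradient_sq hw).differentiableAt (by simp)).hasFDerivAt
    have hmin : IsLocalMin (fun x => Θ x - ‖gradient w x‖ ^ 2) y := by
      filter_upwards [hle] with x hx
      rw [sum_sq_fderiv] at hx
      rw [← hΘeq, sum_sq_fderiv, sub_self]
      linarith
    have h0 := hmin.hasFDerivAt_eq_zero ((hΘC.differentiableAt (by simp)).hasFDerivAt.sub hd)
    rwa [sub_eq_zero.1 h0]
  have hw2 := (hw.fderiv_two.differentiableAt (by simp)).hasFDerivAt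
  have hXd' : fderiv ℝ Θ y (b i₀) = 2 * G * fderiv ℝ (fderiv ℝ w) y (b i₀) (b i₀) := by
    have h1 : HasFDerivAt (fun x => ∑ i, (fderiv ℝ w x (b i)) ^ 2)
        (∑ i, (2 * fderiv ℝ w y (b i)) • (fderiv ℝ (fderiv ℝ w) y).flip (b i)) y := by
      refine HasFDerivAt.fun_sum fun i _ => ?_
      have h := (hw2.clm_apply (hasFDerivAt_const (b i) y)).pow 2
      refine h.congr_fderiv ?_
      ext z
      simp
    simp only [sum_sq_fderiv] at h1
    rw [hXd.unique h1, sum_apply]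
    simp only [smul_apply, ContinuousLinearMap.flip_apply, smul_eq_mul,
      mul_assoc]
    rw [← Finset.mul_sum, hsingle]
  have hΘd : fderiv ℝ Θ y (b i₀) = G ^ 2 * (fderiv ℝ T y (b i₀) - 2 * a * G) := by
    have h1 : HasFDerivAt S (fderiv ℝ T y - (2 * a) • fderiv ℝ w y) y :=
      (hT.differentiableAt (by simp)).hasFDerivAt.sub
        ((hw.differentiableAt (by simp)).hasFDerivAt.const_mul _)
    have h2 : HasFDerivAt Θ (Q • (Real.exp (S y) • (fderiv ℝ T y - (2 * a) • fderiv ℝ w y))) y :=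
      h1.exp.const_mul Q
    rw [h2.fderiv, smul_smul]
    have h3 : Q * Real.exp (S y) = G ^ 2 := hΘy
    rw [h3]
    simp [hwi]
  -- the Laplacian of the touching function
  have hΘΔ : Δ Θ y = G ^ 2 * (‖gradient T y‖ ^ 2 - 4 * a * G * fderiv ℝ T y (b i₀) +
      4 * a ^ 2 * G ^ 2 + Δ T y - 2 * a * Δ w y) := by
    have hd : deriv (fun s => Q * Real.exp s) = fun s => Q * Real.exp s := by
      ext s; simp
    have h1 := laplacian_comp (hφ.contDiffAt (x := S y)) hSC
    rw [hd, hd, ← mul_add] at h1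
    have h3 : (fun s => Q * Real.exp s) (S y) = G ^ 2 := hΘy
    rw [h3] at h1
    have h4 : Δ S y = Δ T y - 2 * a * Δ w y := by
      have e1 := hT.laplacian_sub (contDiffAt_const (c := 2 * a) |>.mul hw)
      have e2 : Δ (fun x => 2 * a * w x) y = 2 * a * Δ w y := laplacian_smul (2 * a) hw
      rw [e2] at e1
      exact e1
    have h5 : ‖gradient S y‖ ^ 2 = ‖gradient T y‖ ^ 2 - 4 * a * G * fderiv ℝ T y (b i₀) +
        4 * a ^ 2 * G ^ 2 := by
      have e1 : HasFDerivAt S (fderiv ℝ T y - (2 * a) • fderiv ℝ w y) y :=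
        (hT.differentiableAt (by simp)).hasFDerivAt.sub
          ((hw.differentiableAt (by simp)).hasFDerivAt.const_mul _)
      have e2 : ∑ i, fderiv ℝ w y (b i) * fderiv ℝ T y (b i) = G * fderiv ℝ T y (b i₀) :=
        hsingle _
      have e3 : ∑ i, (fderiv ℝ w y (b i)) ^ 2 = G ^ 2 := sum_sq_fderiv b w y
      rw [← sum_sq_fderiv b, ← sum_sq_fderiv b T, e1.fderiv, mul_assoc (4 * a), ← e2, ← e3,
        Finset.mul_sum, Finset.mul_sum, ← Finset.sum_sub_distrib, ← Finset.sum_add_distrib]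
      refine Finset.sum_congr rfl fun i _ => ?_
      simp
      ring
    rw [h4, h5] at h1
    rw [show Δ Θ y = _ from h1]
    ring
  -- the right-hand side
  set g : E → ℝ := fun x => -(‖gradient w x‖ ^ 2 + Real.exp ((p - 1) * w x) +
      M * Real.exp ((q - 1) * w x) * (‖gradient w x‖ ^ 2) ^ (q / 2)) with hg
  -- The power `q / 2` may be less than `1`, so a nonzero gradient is what makes `g` of class `C¹`
  -- near `y`.
  have hXne : ‖gradient w y‖ ^ 2 ≠ 0 := by positivity
  have hgC : ContDiffAt ℝ 1 g y := by
    have hX := contDiffAt_norm_gradient_sq hw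
    have hw1 : ContDiffAt ℝ 1 w y := hw.of_le (by norm_num)
    exact ((hX.add (contDiffAt_const.mul hw1).exp).add
      ((contDiffAt_const.mul (contDiffAt_const.mul hw1).exp).mul
        (hX.rpow_const_of_ne hXne))).neg
  have hlap : ∀ᶠ x in 𝓝 y, Δ w x = g x := by
    filter_upwards [heq] with x hx
    simp only [hg]
    rw [← hx, neg_neg]
  set U := Real.exp ((p - 1) * w y) with hU
  set V := M * Real.exp ((q - 1) * w y) * (G ^ 2) ^ (q / 2) with hV
  have hgd : fderiv ℝ g y (b i₀) = -(fderiv ℝ Θ y (b i₀) + (p - 1) * U * G + (q - 1) * V * G +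
      q / 2 * (V / G ^ 2) * fderiv ℝ Θ y (b i₀)) := by
    have hw1 := (hw.differentiableAt (by simp)).hasFDerivAt
    have h := (((hXd.add (hw1.const_mul (p - 1)).exp).add
      (((hw1.const_mul (q - 1)).exp.const_mul M).mul
        (hXd.rpow_const (p := q / 2) (Or.inl hXne)))).neg)
    have h' : HasFDerivAt g _ y := h
    rw [h'.fderiv]
    have hpow : (G ^ 2) ^ (q / 2 - 1) = (G ^ 2) ^ (q / 2) / G ^ 2 :=
      Real.rpow_sub_one hXne _
    simp [hwi, ← hGdef, hpow, hV, hU]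
    ring
  -- conclusion
  have hboch := bochner_of_touching_above b hw hgC hΘC hlap hle hΘeq
  rw [hsingle] at hboch
  have htr := sq_trace_sub_le_sum_sq i₀ fun i j => fderiv ℝ (fderiv ℝ w) y (b i) (b j)
  rw [← laplacian_eq_sum_fderiv b w y] at htr
  set H := ∑ i, ∑ j, (fderiv ℝ (fderiv ℝ w) y (b i) (b j)) ^ 2
  set lam := fderiv ℝ (fderiv ℝ w) y (b i₀) (b i₀)
  have hm : (0 : ℝ) < (N : ℝ) - 1 := by
    have : (2 : ℝ) ≤ N := by exact_mod_cast hN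
    linarith
  set s := fderiv ℝ T y (b i₀)
  -- First-order condition: `|∇w|²` and `Θ` have the same derivative along `∇w` at the touching
  -- point.
  have hlam : lam = G * s / 2 - a * G ^ 2 := by
    have : 2 * G * lam = 2 * G * (G * s / 2 - a * G ^ 2) := by rw [← hXd', hΘd]; ring
    exact mul_left_cancel₀ (by positivity) this
  have hV0 : 0 ≤ V := by positivity
  have hΔw : Δ w y = -(G ^ 2 + U + V) := hlap.self_of_nhds
  have hf := hform (G ^ 2) U V (G * s) lam (by positivity) (Real.exp_pos _).le hV0 hlam
  have hs : s ^ 2 ≤ ‖gradient T y‖ ^ 2 := by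
    rw [← sum_sq_fderiv b]
    exact Finset.single_le_sum (f := fun i => (fderiv ℝ T y (b i)) ^ 2)
      (fun i _ => sq_nonneg _) (Finset.mem_univ i₀)
  have hH : lam ^ 2 + (G ^ 2 + U + V + lam) ^ 2 / ((N : ℝ) - 1) ≤ H := by
    rw [← le_sub_iff_add_le', div_le_iff₀ hm]
    rw [hΔw] at htr
    linarith
  have hGg : G * fderiv ℝ g y (b i₀) = -(2 * G ^ 2 * lam + (p - 1) * U * G ^ 2 +
      (q - 1) * V * G ^ 2 + q * V * lam) := by
    rw [hgd, hXd']
    field_simp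
  rw [hGg, hΘΔ, hΔw] at hboch
  have hGs : G * s = 2 * lam + 2 * a * G ^ 2 := by rw [hlam]; ring
  have hmain : c * (G ^ 4 + U ^ 2) ≤ G ^ 2 * ((1 / 2 + C) * ‖gradient T y‖ ^ 2 + Δ T y / 2) := by
    have e1 : C * (G * s) ^ 2 ≤ C * (G ^ 2 * ‖gradient T y‖ ^ 2) := by
      rw [mul_pow]
      gcongr
    have e2 : 0 ≤ c * V ^ 2 := by positivity
    have e3 : G ^ 2 * (‖gradient T y‖ ^ 2 - 4 * a * G * s + 4 * a ^ 2 * G ^ 2 + Δ T y -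
        2 * a * -(G ^ 2 + U + V)) = G ^ 2 * (‖gradient T y‖ ^ 2 + Δ T y) -
        8 * a * lam * G ^ 2 - 4 * a ^ 2 * (G ^ 2) ^ 2 + 2 * (a * (G ^ 2 + U + V) * G ^ 2) := by
      rw [mul_assoc (4 * a) G s, hGs]
      ring
    rw [e3] at hboch
    generalize (G ^ 2 + U + V + lam) ^ 2 / ((N : ℝ) - 1) = Z at hf hH
    linarith
  have hU0 : 0 < U := Real.exp_pos _
  have hfin2 : G ^ 2 * (c * (G ^ 2 + U)) ≤
      G ^ 2 * ((1 + 2 * C) * ‖gradient T y‖ ^ 2 + Δ T y) := by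
    have e1 : G ^ 2 * (G ^ 2 + U) ≤ 2 * (G ^ 4 + U ^ 2) := by
      have e : 2 * (G ^ 4 + U ^ 2) - G ^ 2 * (G ^ 2 + U) =
          (G ^ 2 - U / 2) ^ 2 + 7 / 4 * U ^ 2 := by ring
      have e' : 0 ≤ (G ^ 2 - U / 2) ^ 2 + 7 / 4 * U ^ 2 := by positivity
      linarith
    have e2 := mul_le_mul_of_nonneg_left e1 hc.le
    linarith
  exact le_of_mul_le_mul_left hfin2 (by positivity)

end PointwiseEstimate

/-! ### The logarithmic barrier and the gradient estimate on balls. -/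

section GradientEstimate

theorem gradient_comp_real {E : Type*} [NormedAddCommGroup E] [InnerProductSpace ℝ E]
    [CompleteSpace E] {φ : ℝ → ℝ} {f : E → ℝ} {x : E} {φ' : ℝ} (hφ : HasDerivAt φ φ' (f x))
    (hf : DifferentiableAt ℝ f x) :
    gradient (fun y => φ (f y)) x = φ' • gradient f x := by
  have h := (hφ.comp_hasFDerivAt x hf.hasFDerivAt).fderiv
  simp only [Function.comp_def] at h
  rw [gradient, h, map_smul, gradient]

theorem laplacian_log_comp {E : Type*} [NormedAddCommGroup E] [InnerProductSpace ℝ E]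
    [FiniteDimensional ℝ E] {f : E → ℝ} {x : E} (hf : ContDiffAt ℝ 2 f x) (h0 : f x ≠ 0) :
    Δ (fun y => Real.log (f y)) x = -(‖gradient f x‖ ^ 2 / f x ^ 2) + Δ f x / f x := by
  rw [laplacian_comp (Real.contDiffAt_log.2 h0) hf, Real.deriv_log', deriv_inv]
  ring

/-- The function `-k log (R² - |x - x₀|²)`, which blows up on the sphere of radius `R`. -/
noncomputable def logBarrier {E : Type*} [NormedAddCommGroup E] (k R : ℝ) (x₀ : E) (x : E) : ℝ :=
  -k * Real.log (R ^ 2 - ‖x - x₀‖ ^ 2)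

section Barrier

variable {E : Type*} [NormedAddCommGroup E] [InnerProductSpace ℝ E] [FiniteDimensional ℝ E]
  {k R : ℝ} {x₀ x : E}

omit [FiniteDimensional ℝ E] in
theorem contDiff_radius_sub (R : ℝ) (x₀ : E) : ContDiff ℝ 2 fun y : E => R ^ 2 - ‖y - x₀‖ ^ 2 :=
  contDiff_const.sub (contDiff_norm_sub_sq x₀)

omit [FiniteDimensional ℝ E] in
theorem contDiffAt_logBarrier (h : 0 < R ^ 2 - ‖x - x₀‖ ^ 2) :
    ContDiffAt ℝ 2 (logBarrier k R x₀) x :=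
  contDiffAt_const.mul ((contDiff_radius_sub R x₀).contDiffAt.log h.ne')

theorem gradient_radius_sub (R : ℝ) (x₀ x : E) :
    gradient (fun y : E => R ^ 2 - ‖y - x₀‖ ^ 2) x = -((2 : ℝ) • (x - x₀)) := by
  have h := gradient_comp_real (φ := fun s => R ^ 2 - s) (f := fun y : E => ‖y - x₀‖ ^ 2) (x := x)
    ((hasDerivAt_id _).const_sub _) ((contDiff_norm_sub_sq x₀).differentiable (by simp) x)
  rw [gradient_norm_sub_sq] at h
  rw [h, neg_one_smul]

theorem laplacian_radius_sub (R : ℝ) (x₀ x : E) :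
    Δ (fun y : E => R ^ 2 - ‖y - x₀‖ ^ 2) x = -(2 * Module.finrank ℝ E) := by
  have h := (contDiffAt_const (c := R ^ 2)).laplacian_sub
    (contDiff_norm_sub_sq x₀).contDiffAt (x := x)
  rw [laplacian_norm_sub_sq, laplacian_const, Pi.zero_apply,
    zero_sub] at h
  exact h

theorem norm_gradient_logBarrier_sq (h : 0 < R ^ 2 - ‖x - x₀‖ ^ 2) :
    ‖gradient (logBarrier k R x₀) x‖ ^ 2 =
      4 * k ^ 2 * ‖x - x₀‖ ^ 2 / (R ^ 2 - ‖x - x₀‖ ^ 2) ^ 2 := by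
  have h1 : HasDerivAt (fun s => -k * Real.log s) (-k * (R ^ 2 - ‖x - x₀‖ ^ 2)⁻¹)
    (R ^ 2 - ‖x - x₀‖ ^ 2) := (Real.hasDerivAt_log h.ne').const_mul _
  have h2 := gradient_comp_real (f := fun y : E => R ^ 2 - ‖y - x₀‖ ^ 2) (x := x) h1
    ((contDiff_radius_sub R x₀).differentiable (by simp) x)
  rw [gradient_radius_sub] at h2
  have h3 : gradient (logBarrier k R x₀) x = _ := h2
  rw [h3, norm_smul, norm_neg, norm_smul, mul_pow, mul_pow, Real.norm_eq_abs, sq_abs]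
  field_simp
  norm_num

theorem laplacian_logBarrier (h : 0 < R ^ 2 - ‖x - x₀‖ ^ 2) :
    Δ (logBarrier k R x₀) x = k * (4 * ‖x - x₀‖ ^ 2 / (R ^ 2 - ‖x - x₀‖ ^ 2) ^ 2 +
      2 * Module.finrank ℝ E / (R ^ 2 - ‖x - x₀‖ ^ 2)) := by
  have hC := (contDiff_radius_sub R x₀).contDiffAt (x := x)
  have h1 : Δ (logBarrier k R x₀) x =
      -k * Δ (fun y => Real.log (R ^ 2 - ‖y - x₀‖ ^ 2)) x := laplacian_smul (-k) (hC.log h.ne')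
  rw [h1, laplacian_log_comp hC h.ne', gradient_radius_sub, laplacian_radius_sub, norm_neg,
    norm_smul, mul_pow]
  norm_num
  ring

/-- With `η = R² - |x - x₀|²`, both `|x - x₀|² / η²` and `1 / η` are at most `R² / η²`, because `η ≤
R²`. -/
theorem logBarrier_bound {C : ℝ} (hC : 0 ≤ C) (hk : 0 ≤ k) (h : 0 < R ^ 2 - ‖x - x₀‖ ^ 2) :
    (1 + 2 * C) * ‖gradient (logBarrier k R x₀) x‖ ^ 2 + Δ (logBarrier k R x₀) x ≤
      ((1 + 2 * C) * (4 * k ^ 2) + k * (4 + 2 * Module.finrank ℝ E)) *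
        (R ^ 2 / (R ^ 2 - ‖x - x₀‖ ^ 2) ^ 2) := by
  rw [norm_gradient_logBarrier_sq h, laplacian_logBarrier h]
  set η := R ^ 2 - ‖x - x₀‖ ^ 2 with hη
  have h1 : ‖x - x₀‖ ^ 2 / η ^ 2 ≤ R ^ 2 / η ^ 2 := by gcongr ?_ / _; linarith
  have h2 : 1 / η ≤ R ^ 2 / η ^ 2 := by
    rw [div_le_div_iff₀ h (by positivity)]
    nlinarith [sq_nonneg ‖x - x₀‖]
  calc _ = ((1 + 2 * C) * (4 * k ^ 2) + 4 * k) * (‖x - x₀‖ ^ 2 / η ^ 2) +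
        2 * k * Module.finrank ℝ E * (1 / η) := by ring
    _ ≤ ((1 + 2 * C) * (4 * k ^ 2) + 4 * k) * (R ^ 2 / η ^ 2) +
        2 * k * Module.finrank ℝ E * (R ^ 2 / η ^ 2) := by gcongr
    _ = _ := by ring

omit [InnerProductSpace ℝ E] [FiniteDimensional ℝ E] in
theorem exp_neg_logBarrier (h : 0 < R ^ 2 - ‖x - x₀‖ ^ 2) :
    Real.exp (-logBarrier k R x₀ x) = (R ^ 2 - ‖x - x₀‖ ^ 2) ^ k := by
  rw [logBarrier, Real.rpow_def_of_pos h]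
  congr 1
  ring

end Barrier

variable {N : ℕ} {p q M : ℝ} {Ω : Set (EuclideanSpace ℝ (Fin N))}
  {u : EuclideanSpace ℝ (Fin N) → ℝ}

theorem IsSolutionIn.contDiffAt (hu : IsSolutionIn p q M Ω u) (hΩ : IsOpen Ω)
    {x : EuclideanSpace ℝ (Fin N)} (hx : x ∈ Ω) : ContDiffAt ℝ 2 u x :=
  hu.contDiffOn.contDiffAt (hΩ.mem_nhds hx)

theorem IsSolutionIn.gradient_log (hu : IsSolutionIn p q M Ω u) (hΩ : IsOpen Ω)
    {x : EuclideanSpace ℝ (Fin N)} (hx : x ∈ Ω) (h0 : 0 < u x) :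
    gradient (fun y => Real.log (u y)) x = (u x)⁻¹ • gradient u x :=
  gradient_comp_real (Real.hasDerivAt_log h0.ne')
    ((hu.contDiffAt hΩ hx).differentiableAt (by simp))

theorem IsSolutionIn.laplacian_log (hu : IsSolutionIn p q M Ω u) (hΩ : IsOpen Ω)
    {x : EuclideanSpace ℝ (Fin N)} (hx : x ∈ Ω) (h0 : 0 < u x) :
    -Δ (fun y => Real.log (u y)) x = ‖gradient (fun y => Real.log (u y)) x‖ ^ 2 +
      Real.exp ((p - 1) * Real.log (u x)) + M * Real.exp ((q - 1) * Real.log (u x)) *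
        (‖gradient (fun y => Real.log (u y)) x‖ ^ 2) ^ (q / 2) := by
  have hexp (s : ℝ) : Real.exp (s * Real.log (u x)) = u x ^ s := by
    rw [Real.rpow_def_of_pos h0, mul_comm]
  have heq := hu.equation x hx
  rw [abs_of_pos h0] at heq
  rw [laplacian_log_comp (hu.contDiffAt hΩ hx) h0.ne', hu.gradient_log hΩ hx h0, hexp, hexp,
    ← Real.rpow_natCast_mul (norm_nonneg _), norm_smul, Real.norm_eq_abs, abs_of_pos (inv_pos.2 h0)]
  have h2 : ((2 : ℕ) : ℝ) * (q / 2) = q := by push_cast; ring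
  rw [h2, Real.mul_rpow (inv_pos.2 h0).le (norm_nonneg _), Real.inv_rpow h0.le,
    Real.rpow_sub_one h0.ne']
  have h3 : Δ u x = -(u x ^ (p - 1) * u x + M * ‖gradient u x‖ ^ q) := by linarith
  have h4 : 0 < u x ^ q := Real.rpow_pos_of_pos h0 q
  simp only [h3, Real.rpow_sub_one h0.ne']
  field_simp
  ring

/-- The bound for `|∇u|² u^(2a-2)` from the inequality at a maximum of its product with a cutoff. -/
theorem rpow_mul_le_of_add_le {X w η R a C k : ℝ} (hp : 1 < p) (ha : 0 < a) (hX : 0 ≤ X)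
    (hη : 0 < η) (hR : 0 ≤ R) (hC : 0 ≤ C) (hk : k = 2 * (2 * a / (p - 1) + 1))
    (h : X + Real.exp ((p - 1) * w) ≤ C * (R ^ 2 / η ^ 2)) :
    X * Real.exp (2 * a * w) * η ^ k ≤ C ^ (k / 2) * R ^ k := by
  have hp0 : 0 < p - 1 := by linarith
  have hk0 : 0 < k := by rw [hk]; positivity
  -- This weight is the one with `2as = (p-1)(1-s)`, so that `(X e^(2aw))^s` is the geometric mean
  -- of `X` and `e^((p-1)w)` with weights `s` and `1 - s`. It explains the value of `k`.
  set s := 2 / k with hs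
  have hs0 : 0 < s := by positivity
  have hs1 : s ≤ 1 := by
    rw [hs, div_le_one hk0, hk]
    have : 0 < 2 * a / (p - 1) := by positivity
    linarith
  have hkey : 2 * a * s = (p - 1) * (1 - s) := by
    rw [hs, hk]
    field_simp
    ring
  have h1 : (X * Real.exp (2 * a * w)) ^ s ≤ X + Real.exp ((p - 1) * w) := by
    have hg := Real.geom_mean_le_arith_mean2_weighted hs0.le (sub_nonneg.2 hs1) hX
      (Real.exp_pos ((p - 1) * w)).le (by ring)
    have e : Real.exp ((p - 1) * w) ^ (1 - s) = Real.exp (2 * a * w) ^ s := by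
      rw [← Real.exp_mul, ← Real.exp_mul]
      congr 1
      linear_combination -w * hkey
    rw [e] at hg
    rw [Real.mul_rpow hX (Real.exp_pos _).le]
    have := (Real.exp_pos ((p - 1) * w)).le
    nlinarith
  have h2 := h1.trans h
  have hF : 0 ≤ X * Real.exp (2 * a * w) := by positivity
  have hsk : s * (k / 2) = 1 := by rw [hs]; field_simp
  have h3 : X * Real.exp (2 * a * w) ≤ (C * (R ^ 2 / η ^ 2)) ^ (k / 2) := by
    calc X * Real.exp (2 * a * w) = ((X * Real.exp (2 * a * w)) ^ s) ^ (k / 2) := by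
          rw [← Real.rpow_mul hF, hsk, Real.rpow_one]
      _ ≤ _ := by gcongr
  have hsq {z : ℝ} (hz : 0 ≤ z) : (z ^ 2) ^ (k / 2) = z ^ k := by
    rw [← Real.rpow_natCast_mul hz]
    congr 1
    push_cast
    ring
  rw [Real.mul_rpow hC (by positivity), Real.div_rpow (by positivity) (by positivity), hsq hR,
    hsq hη.le] at h3
  have hηk : 0 < η ^ k := Real.rpow_pos_of_pos hη k
  calc X * Real.exp (2 * a * w) * η ^ k ≤ C ^ (k / 2) * (R ^ k / η ^ k) * η ^ k := by gcongr
    _ = _ := by field_simp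

theorem interior_gradient_estimate (hN : 2 ≤ N) (hp : 1 < p)
    (hp' : p < ((N : ℝ) + 3) / ((N : ℝ) - 1)) (hq : 1 < q) (hq' : q < ((N : ℝ) + 2) / (N : ℝ)) :
    ∃ a c : ℝ, 0 < a ∧ 0 < c ∧
      ∀ Ω : Set (EuclideanSpace ℝ (Fin N)), IsOpen Ω → ∀ M : ℝ, 0 < M →
        ∀ u : EuclideanSpace ℝ (Fin N) → ℝ, IsSolutionIn p q M Ω u → (∀ x ∈ Ω, 0 < u x) →
          ∀ x₀ R, 0 < R → Metric.closedBall x₀ R ⊆ Ω →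
            ‖gradient (fun y => u y ^ a) x₀‖ ≤ c * R ^ (-(2 * a / (p - 1)) - 1) := by
  have hN' : (2 : ℝ) ≤ N := by exact_mod_cast hN
  have hm : (0 : ℝ) < (N : ℝ) - 1 := by linarith
  rw [lt_div_iff₀ hm] at hp'
  rw [lt_div_iff₀ (by linarith)] at hq'
  obtain ⟨a, c, C, ha, hc, hC, hform⟩ := quadratic_form_lower_bound (p := p) (q := q) hm
    (by linarith) (by nlinarith) (by linarith)
  have hp0 : 0 < p - 1 := by linarith
  set k := 2 * (2 * a / (p - 1) + 1) with hk
  have hk0 : 0 < k := by positivity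
  set C₂ := ((1 + 2 * C) * (4 * k ^ 2) + k * (4 + 2 * N)) / c with hC₂
  have hC₂0 : 0 < C₂ := by positivity
  refine ⟨a, a * C₂ ^ (k / 4), ha, by positivity, ?_⟩
  intro Ω hΩ M hM u hu hpos x₀ R hR hball
  set w : EuclideanSpace ℝ (Fin N) → ℝ := fun y => Real.log (u y) with hw
  have hwC {x} (hx : x ∈ Ω) : ContDiffAt ℝ 2 w x := (hu.contDiffAt hΩ hx).log (hpos x hx).ne'
  have hx₀ : x₀ ∈ Ω := hball (Metric.mem_closedBall_self hR.le)
  have hgrad : ‖gradient (fun y => u y ^ a) x₀‖ ^ 2 =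
      a ^ 2 * (‖gradient w x₀‖ ^ 2 * Real.exp (2 * a * w x₀)) := by
    have h0 := hpos x₀ hx₀
    rw [gradient_comp_real (Real.hasDerivAt_rpow_const (Or.inl h0.ne'))
      ((hu.contDiffAt hΩ hx₀).differentiableAt (by simp)), hw, hu.gradient_log hΩ hx₀ h0]
    have e : Real.exp (2 * a * Real.log (u x₀)) = (u x₀ ^ a) ^ 2 := by
      rw [Real.rpow_def_of_pos h0, ← Real.exp_nat_mul]
      congr 1
      push_cast
      ring
    rw [e, Real.rpow_sub_one h0.ne', norm_smul, norm_smul, mul_pow, mul_pow, Real.norm_eq_abs,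
      sq_abs, Real.norm_eq_abs, sq_abs]
    ring
  suffices hF : ‖gradient w x₀‖ ^ 2 * Real.exp (2 * a * w x₀) ≤ C₂ ^ (k / 2) * R ^ (-k) by
    refine le_of_sq_le_sq ?_ (by positivity)
    rw [hgrad, mul_pow, mul_pow, ← Real.rpow_mul_natCast hC₂0.le,
      ← Real.rpow_mul_natCast hR.le]
    have e1 : k / 4 * ((2 : ℕ) : ℝ) = k / 2 := by push_cast; ring
    have e2 : (-(2 * a / (p - 1)) - 1) * ((2 : ℕ) : ℝ) = -k := by rw [hk]; push_cast; ring
    rw [e1, e2]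
    calc _ ≤ a ^ 2 * (C₂ ^ (k / 2) * R ^ (-k)) := by gcongr
      _ = _ := by ring
  -- The factor with exponent `k > 0` vanishes on the sphere, so a positive maximum is interior.
  -- Inside the ball it equals `exp (-T)` for the barrier `T = logBarrier k R x₀`.
  set Φ : EuclideanSpace ℝ (Fin N) → ℝ := fun x =>
    ‖gradient w x‖ ^ 2 * Real.exp (2 * a * w x) * (R ^ 2 - ‖x - x₀‖ ^ 2) ^ k with hΦ
  have hη {x} : x ∈ Metric.ball x₀ R ↔ 0 < R ^ 2 - ‖x - x₀‖ ^ 2 := by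
    rw [mem_ball_iff_norm, sub_pos, sq_lt_sq₀ (norm_nonneg _) hR.le]
  have hΦc : ContinuousOn Φ (Metric.closedBall x₀ R) := by
    intro x hx
    have h1 := (contDiffAt_norm_gradient_sq (hwC (hball hx))).continuousAt
    have h2 := (hwC (hball hx)).continuousAt
    have h3 : ContinuousAt (fun x => (R ^ 2 - ‖x - x₀‖ ^ 2) ^ k) x :=
      (contDiff_radius_sub R x₀).continuous.continuousAt.rpow_const (Or.inr hk0.le)
    exact ((h1.mul (continuousAt_const.mul h2).rexp).mul h3).continuousWithinAt
  obtain ⟨y, hy, hmax⟩ := (isCompact_closedBall x₀ R).exists_isMaxOn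
    ⟨x₀, Metric.mem_closedBall_self hR.le⟩ hΦc
  -- At the centre the cutoff equals `R^(2k)`, while the maximum is bounded by a multiple of `R^k`;
  -- the quotient gives the scale `R^(-k)`.
  have hΦ0 : Φ x₀ = ‖gradient w x₀‖ ^ 2 * Real.exp (2 * a * w x₀) * R ^ (k + k) := by
    simp only [hΦ, sub_self, norm_zero]
    have e : ((2 : ℕ) : ℝ) * k = k + k := by push_cast; ring
    rw [show R ^ 2 - (0 : ℝ) ^ 2 = R ^ 2 by ring, ← Real.rpow_natCast_mul hR.le, e]
  by_cases hg0 : gradient w x₀ = 0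
  · rw [hg0]
    simp
    positivity
  have hΦx₀ : 0 < Φ x₀ := by
    rw [hΦ0]
    have : 0 < ‖gradient w x₀‖ := norm_pos_iff.2 hg0
    positivity
  have hle : Φ x₀ ≤ Φ y := hmax (Metric.mem_closedBall_self hR.le)
  have hΦy : 0 < Φ y := hΦx₀.trans_le hle
  have hyη : 0 < R ^ 2 - ‖y - x₀‖ ^ 2 := by
    have h0 : 0 ≤ R ^ 2 - ‖y - x₀‖ ^ 2 := by
      rw [mem_closedBall_iff_norm] at hy
      rw [sub_nonneg]
      gcongr
    refine h0.lt_of_ne fun h => ?_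
    simp [hΦ, ← h, Real.zero_rpow hk0.ne'] at hΦy
  have hgy : gradient w y ≠ 0 := by
    intro h
    simp [hΦ, h] at hΦy
  have hΩy := hball hy
  have hest := estimate_of_isLocalMax (by simp : Module.finrank ℝ (EuclideanSpace ℝ (Fin N)) = N)
    hN hM.le hC hform hc (hwC hΩy) (contDiffAt_logBarrier (k := k) hyη)
    (by
      filter_upwards [hΩ.mem_nhds hΩy] with x hx
      exact hu.laplacian_log hΩ hx (hpos x hx))
    (by
      filter_upwards [Metric.isOpen_ball.mem_nhds (hη.2 hyη)] with x hx
      have h1 := hmax (Metric.ball_subset_closedBall hx)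
      simp only [hΦ, Set.mem_ofPred_eq] at h1
      rw [sub_eq_add_neg, sub_eq_add_neg, Real.exp_add, Real.exp_add, exp_neg_logBarrier hyη,
        exp_neg_logBarrier (hη.1 hx), ← mul_assoc, ← mul_assoc]
      exact h1) hgy
  have hbar := hest.trans (logBarrier_bound hC hk0.le hyη)
  rw [finrank_euclideanSpace_fin, ← le_div_iff₀' hc, mul_div_right_comm, ← hC₂] at hbar
  have hfinal := rpow_mul_le_of_add_le hp ha (sq_nonneg _) hyη hR.le hC₂0.le hk hbar
  have hle' := hle.trans hfinal
  rw [hΦ0, Real.rpow_add hR, ← mul_assoc] at hle'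
  rw [Real.rpow_neg hR.le, ← div_eq_mul_inv, le_div_iff₀ (by positivity)]
  exact le_of_mul_le_mul_right hle' (by positivity)

end GradientEstimate

/-! ### The strong minimum principle by Hopf's argument. -/

section StrongMinimumPrinciple

variable {E : Type*} [NormedAddCommGroup E] [InnerProductSpace ℝ E] [FiniteDimensional ℝ E]

/-- Hopf's comparison function `exp (-α |x - c|²) - exp (-α r²)`. -/
noncomputable def hopfBarrier (α r : ℝ) (c : E) (x : E) : ℝ :=
  Real.exp (-α * ‖x - c‖ ^ 2) - Real.exp (-α * r ^ 2)

omit [FiniteDimensional ℝ E] in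
theorem contDiff_hopfBarrier (α r : ℝ) (c : E) : ContDiff ℝ 2 (hopfBarrier α r c) :=
  (contDiff_const.mul (contDiff_norm_sub_sq c)).exp.sub contDiff_const

theorem laplacian_hopfBarrier (α r : ℝ) (c x : E) :
    Δ (hopfBarrier α r c) x =
      2 * α * Real.exp (-α * ‖x - c‖ ^ 2) * (2 * α * ‖x - c‖ ^ 2 - Module.finrank ℝ E) := by
  have hφ : ContDiff ℝ 2 fun s => Real.exp (-α * s) - Real.exp (-α * r ^ 2) :=
    (contDiff_const.mul contDiff_id).exp.sub contDiff_const
  have h1 (s : ℝ) (K : ℝ) : HasDerivAt (fun s => K * Real.exp (-α * s))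
      (-α * K * Real.exp (-α * s)) s := by
    have h := (((hasDerivAt_id s).const_mul (-α)).exp).const_mul K
    refine h.congr_deriv ?_
    simp
    ring
  have hd : deriv (fun s => Real.exp (-α * s) - Real.exp (-α * r ^ 2)) =
      fun s => -α * Real.exp (-α * s) := by
    ext s
    have h := ((h1 s 1).sub_const (Real.exp (-α * r ^ 2))).deriv
    simpa using h
  have h2 := laplacian_comp (f := fun y : E => ‖y - c‖ ^ 2) (x := x) hφ.contDiffAt
     (contDiff_norm_sub_sq c).contDiffAt
  rw [hd, (h1 _ _).deriv, gradient_norm_sub_sq, laplacian_norm_sub_sq, norm_smul, mul_pow] at h2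
  refine Eq.trans h2 ?_
  norm_num
  ring

omit [FiniteDimensional ℝ E] in
theorem fderiv_hopfBarrier (α r : ℝ) (c x : E) :
    fderiv ℝ (hopfBarrier α r c) x (c - x) =
      2 * α * ‖x - c‖ ^ 2 * Real.exp (-α * ‖x - c‖ ^ 2) := by
  have h1 : HasFDerivAt (hopfBarrier α r c) _ x :=
    (((hasFDerivAt_norm_sub_sq c x).const_mul (-α)).exp).sub_const _
  rw [h1.fderiv]
  have h2 : inner ℝ (x - c) (c - x) = -‖x - c‖ ^ 2 := by
    rw [← neg_sub x c, inner_neg_right, real_inner_self_eq_norm_sq]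
  change Real.exp (-α * ‖x - c‖ ^ 2) * (-α * (2 • inner ℝ (x - c) (c - x))) = _
  rw [h2]
  simp
  ring

/-- The strong minimum principle for nonnegative superharmonic functions. -/
theorem pos_of_laplacian_nonpos {v : E → ℝ} (hv : ContDiff ℝ 2 v) (hΔ : ∀ x, Δ v x ≤ 0)
    (h0 : ∀ x, 0 ≤ v x) {c : E} (hc : 0 < v c) (x : E) : 0 < v x := by
  by_contra! hx
  have hZc : IsClosed (v ⁻¹' {0}) := isClosed_singleton.preimage hv.continuous
  have hZn : (v ⁻¹' {0}).Nonempty := ⟨x, le_antisymm hx (h0 x)⟩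
  -- `y` is a zero of `v` nearest to `c`, so `v` is positive in the open ball about `c` with `y` on
  -- its boundary.
  obtain ⟨y, hy, hdist⟩ := hZc.exists_infDist_eq_dist hZn c
  have hvy : v y = 0 := hy
  set r := dist c y with hr
  have hr0 : 0 < r := by
    refine dist_pos.2 fun h => ?_
    rw [h, hvy] at hc
    exact hc.false
  have hpos {z : E} (hz : ‖z - c‖ < r) : 0 < v z := by
    refine (h0 z).lt_of_ne' fun h => ?_
    have := Metric.infDist_le_dist_of_mem (s := v ⁻¹' {0}) (x := c) h
    rw [hdist, dist_comm, dist_eq_norm] at this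
    exact absurd hz this.not_gt
  obtain ⟨z₀, hz₀, hz₀min⟩ := (isCompact_closedBall c (r / 2)).exists_isMinOn
    ⟨c, Metric.mem_closedBall_self (by positivity)⟩ hv.continuous.continuousOn
  set μ := v z₀
  have hμ : 0 < μ := hpos (by
    rw [mem_closedBall_iff_norm] at hz₀
    linarith)
  -- Chosen so that `2α(r/2)² = dim E + 1`, which makes the barrier strictly subharmonic outside the
  -- ball of radius `r / 2`.
  set α := 2 * ((Module.finrank ℝ E : ℝ) + 1) / r ^ 2 with hα
  have hα0 : 0 < α := by positivity
  set h := hopfBarrier α r c with hh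
  have hhC : ContDiff ℝ 2 h := contDiff_hopfBarrier α r c
  have hh1 (z : E) : h z ≤ 1 := by
    have e1 : Real.exp (-α * ‖z - c‖ ^ 2) ≤ 1 := Real.exp_le_one_iff.2 (by
      have : 0 ≤ α * ‖z - c‖ ^ 2 := by positivity
      linarith)
    have e2 := Real.exp_pos (-α * r ^ 2)
    simp only [hh, hopfBarrier]
    linarith
  have hdC : ContDiff ℝ 2 fun z => v z - μ * h z := hv.sub (contDiff_const.mul hhC)
  -- A negative minimum cannot lie in the inner ball, where `v ≥ μ ≥ μh`, nor on the sphere, where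
  -- `h = 0`; in the annulus it would contradict `Δ(v - μh) < 0`.
  have hcomp : ∀ z ∈ Metric.closedBall c r, 0 ≤ v z - μ * h z := by
    obtain ⟨m, hm, hmin⟩ := (isCompact_closedBall c r).exists_isMinOn
      ⟨c, Metric.mem_closedBall_self hr0.le⟩ hdC.continuous.continuousOn
    suffices 0 ≤ v m - μ * h m from fun z hz => this.trans (hmin hz)
    by_contra! hneg
    have hm1 : r / 2 < ‖m - c‖ := by
      by_contra! hle
      have e1 : μ ≤ v m := hz₀min (mem_closedBall_iff_norm.2 hle)
      nlinarith [hh1 m]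
    have hm2 : ‖m - c‖ < r := by
      refine (mem_closedBall_iff_norm.1 hm).lt_of_ne fun he => ?_
      have : h m = 0 := by simp only [hh, hopfBarrier, he, sub_self]
      rw [this] at hneg
      linarith [h0 m]
    have hloc : IsLocalMax (-fun z => v z - μ * h z) m :=
      (hmin.isLocalMin (Metric.closedBall_mem_nhds_of_mem (mem_ball_iff_norm.2 hm2))).neg
    have e1 := laplacian_nonpos_of_isLocalMax hloc hdC.contDiffAt.neg
    have e2 : Δ (fun z => v z - μ * h z) m = Δ v m - μ * Δ h m := by
      have e3 := hv.contDiffAt.laplacian_sub (x := m) (contDiff_const.mul hhC).contDiffAt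
        (f₂ := fun z => μ * h z)
      have e4 : Δ (fun z => μ * h z) m = μ * Δ h m := laplacian_smul μ hhC.contDiffAt
      rw [e4] at e3
      exact e3
    rw [laplacian_neg, Pi.neg_apply, e2, hh, laplacian_hopfBarrier] at e1
    have e3 : 0 < 2 * α * ‖m - c‖ ^ 2 - Module.finrank ℝ E := by
      have e4 : (r / 2) ^ 2 < ‖m - c‖ ^ 2 := by gcongr
      have e5 : 2 * α * (r / 2) ^ 2 = Module.finrank ℝ E + 1 := by
        rw [hα]
        field_simp
      have e6 : 2 * α * (r / 2) ^ 2 ≤ 2 * α * ‖m - c‖ ^ 2 := by gcongr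
      linarith
    have e4 : 0 < μ * (2 * α * Real.exp (-α * ‖m - c‖ ^ 2) *
      (2 * α * ‖m - c‖ ^ 2 - Module.finrank ℝ E)) := by positivity
    linarith [hΔ m]
  have hyr : ‖y - c‖ = r := by rw [hr, dist_comm, dist_eq_norm]
  have hhy : h y = 0 := by simp only [hh, hopfBarrier, hyr, sub_self]
  have hmin : IsMinOn (fun z => v z - μ * h z) (Metric.closedBall c r) y := by
    intro z hz
    simpa [hvy, hhy] using hcomp z hz
  have hcone : c - y ∈ posTangentConeAt (Metric.closedBall c r) y :=
    sub_mem_posTangentConeAt_of_segment_subset ((convex_closedBall c r).segment_subset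
      (mem_closedBall_iff_norm.2 hyr.le) (Metric.mem_closedBall_self hr0.le))
  have hvd : fderiv ℝ v y = 0 := by
    refine IsLocalMin.fderiv_eq_zero (Eventually.of_forall fun z => ?_)
    rw [hvy]
    exact h0 z
  have hd : HasFDerivAt (fun z => v z - μ * h z) (fderiv ℝ v y - μ • fderiv ℝ h y) y :=
    (hv.differentiable (by simp) y).hasFDerivAt.sub
      ((hhC.differentiable (by simp) y).hasFDerivAt.const_mul μ)
  -- At `y` the inward derivative of `v - μh` is nonnegative; but `∇v = 0` there, since `y` is a
  -- global minimum of `v`, while `h` strictly increases inwards.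
  have hfin := hmin.localize.hasFDerivWithinAt_nonneg hd.hasFDerivWithinAt hcone
  rw [hvd, zero_sub, neg_apply, smul_apply, hh, fderiv_hopfBarrier, hyr, smul_eq_mul] at hfin
  have : 0 < μ * (2 * α * r ^ 2 * Real.exp (-α * r ^ 2)) := by positivity
  linarith

end StrongMinimumPrinciple

/-! ### From balls inside the domain to the distance to its boundary. -/

section Distance

/-- The ball is connected and misses the frontier, so it cannot meet both `Ω` and the exterior. -/
theorem closedBall_subset_of_lt_infEDist_frontier {E : Type*} [NormedAddCommGroup E]
    [NormedSpace ℝ E] {Ω : Set E} (hΩ : IsOpen Ω) {x : E} (hx : x ∈ Ω) {R : ℝ} (hR : 0 ≤ R)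
    (h : ENNReal.ofReal R < Metric.infEDist x (frontier Ω)) : Metric.closedBall x R ⊆ Ω := by
  refine IsPreconnected.subset_left_of_subset_union hΩ
    isClosed_closure.isOpen_compl (disjoint_compl_right.mono_left subset_closure)
    (fun z hz => ?_) ⟨x, Metric.mem_closedBall_self hR, hx⟩
    (convex_closedBall x R).isPreconnected
  by_contra hn
  simp only [Set.mem_union, Set.mem_compl_iff, not_or, not_not] at hn
  have hf : z ∈ frontier Ω := by
    rw [hΩ.frontier_eq]
    exact ⟨hn.2, hn.1⟩
  have h1 := Metric.infEDist_le_edist_of_mem (x := x) hf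
  have h2 : edist x z ≤ ENNReal.ofReal R := by
    rw [edist_dist, dist_comm]
    exact ENNReal.ofReal_le_ofReal hz
  exact absurd h (h1.trans h2).not_gt

theorem le_mul_infEDist_rpow_of_forall {E : Type*} [NormedAddCommGroup E]
    [NormedSpace ℝ E] {Ω : Set E} (hΩ : IsOpen Ω) {x : E} (hx : x ∈ Ω) {G c β : ℝ} (hc : 0 ≤ c)
    (h : ∀ R, 0 < R → Metric.closedBall x R ⊆ Ω → G ≤ c * R ^ β) :
    ENNReal.ofReal G ≤ ENNReal.ofReal c * Metric.infEDist x (frontier Ω) ^ β := by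
  set d := Metric.infEDist x (frontier Ω) with hd
  have hd0 : 0 < d := by
    refine pos_iff_ne_zero.2 fun h0 => ?_
    rw [hd, ← Metric.mem_iff_infEDist_zero_of_closed isClosed_frontier, hΩ.frontier_eq] at h0
    exact h0.2 hx
  -- Letting the radius increase to `d` in `ENNReal` treats finite and infinite distance together.
  have : (𝓝[<] d).NeBot := nhdsLT_neBot_of_exists_lt ⟨0, hd0⟩
  have hlim : Tendsto (fun t : ENNReal => ENNReal.ofReal c * t ^ β) (𝓝[<] d)
      (𝓝 (ENNReal.ofReal c * d ^ β)) :=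
    ENNReal.Tendsto.const_mul ((ENNReal.continuous_rpow_const.tendsto d).mono_left
      nhdsWithin_le_nhds) (Or.inr ENNReal.ofReal_ne_top)
  refine ge_of_tendsto hlim ?_
  filter_upwards [Ioo_mem_nhdsLT hd0] with t ht
  have htop : t ≠ ⊤ := ht.2.ne_top
  have ht0 : 0 < t.toReal := ENNReal.toReal_pos ht.1.ne' htop
  have h1 := h t.toReal ht0 (closedBall_subset_of_lt_infEDist_frontier hΩ hx ht0.le (by
    rw [ENNReal.ofReal_toReal htop]
    exact ht.2))
  calc ENNReal.ofReal G ≤ ENNReal.ofReal (c * t.toReal ^ β) := ENNReal.ofReal_le_ofReal h1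
    _ = _ := by
      rw [ENNReal.ofReal_mul hc, ← ENNReal.ofReal_rpow_of_pos ht0, ENNReal.ofReal_toReal htop]

end Distance

end Preliminaries

/-! ### The main theorem. -/

theorem theoremD (N : ℕ) (hN : 2 ≤ N) (p q : ℝ)
    (hp : 1 < p) (hp' : p < ((N : ℝ) + 3) / ((N : ℝ) - 1))
    (hq : 1 < q) (hq' : q < ((N : ℝ) + 2) / (N : ℝ)) :
    -- the gradient estimate; `a` and `c` are chosen before `Ω`, `M` and `u`.
    -- For `Ω = ℝ^N` the boundary is empty, the distance is `∞` and the right-hand side is `0`.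
    (∃ a c : ℝ, 0 < a ∧ 0 < c ∧
      ∀ Ω : Set (EuclideanSpace ℝ (Fin N)), IsOpen Ω → IsConnected Ω →
        ∀ M : ℝ, 0 < M →
          ∀ u : EuclideanSpace ℝ (Fin N) → ℝ, IsSolutionIn p q M Ω u → (∀ x ∈ Ω, 0 < u x) →
            ∀ x ∈ Ω,
              ENNReal.ofReal ‖gradient (fun y => u y ^ a) x‖ ≤
                ENNReal.ofReal c *
                  Metric.infEDist x (frontier Ω) ^ (-(2 * a / (p - 1)) - 1)) ∧
    -- nonexistence in the whole space
    (∀ M : ℝ, 0 < M →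
      ¬ ∃ u : EuclideanSpace ℝ (Fin N) → ℝ,
        IsSolutionIn p q M Set.univ u ∧ (∀ x, 0 ≤ u x) ∧ ∃ x, u x ≠ 0) := by
  have hest := interior_gradient_estimate hN hp hp' hq hq'
  have hp0 : 0 < p - 1 := by linarith
  obtain ⟨a, c, ha, hc, h⟩ := hest
  have hmain : ∀ Ω : Set (EuclideanSpace ℝ (Fin N)), IsOpen Ω →
      ∀ M : ℝ, 0 < M →
        ∀ u : EuclideanSpace ℝ (Fin N) → ℝ, IsSolutionIn p q M Ω u → (∀ x ∈ Ω, 0 < u x) →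
          ∀ x ∈ Ω,
            ENNReal.ofReal ‖gradient (fun y => u y ^ a) x‖ ≤
              ENNReal.ofReal c *
                Metric.infEDist x (frontier Ω) ^ (-(2 * a / (p - 1)) - 1) :=
    fun Ω hΩ M hM u hu hpos x hx => le_mul_infEDist_rpow_of_forall hΩ hx hc.le
      fun R hR hball => h Ω hΩ M hM u hu hpos x R hR hball
  refine ⟨⟨a, c, ha, hc, fun Ω hΩ _ => hmain Ω hΩ⟩, ?_⟩
  rintro M hM ⟨u, hu, hnn, x₁, hx₁⟩
  have hC : ContDiff ℝ 2 u := contDiffOn_univ.1 hu.contDiffOn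
  have hpos : ∀ x, 0 < u x := by
    refine pos_of_laplacian_nonpos hC (fun x => ?_) hnn ((hnn x₁).lt_of_ne' hx₁)
    have h1 := hu.equation x (Set.mem_univ x)
    have h2 : 0 ≤ |u x| ^ (p - 1) * u x + M * ‖gradient u x‖ ^ q := by
      have := hnn x
      positivity
    linarith
  have hgrad : ∀ x, gradient u x = 0 := by
    intro x
    have h1 := hmain Set.univ isOpen_univ M hM u hu (fun x _ => hpos x) x (Set.mem_univ x)
    have hexp : -(2 * a / (p - 1)) - 1 < 0 := by
      have : 0 < 2 * a / (p - 1) := by positivity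
      linarith
    -- An infinite distance to a negative power is `0`, so `∇(u^a) = 0`; the factor `a u^(a-1)` is
    -- positive, so `∇u = 0`.
    rw [frontier_univ, Metric.infEDist_empty, ENNReal.top_rpow_of_neg hexp, mul_zero,
      nonpos_iff_eq_zero, ENNReal.ofReal_eq_zero, norm_le_zero_iff,
      gradient_comp_real (Real.hasDerivAt_rpow_const (Or.inl (hpos x).ne'))
        (hC.differentiable (by simp) x), smul_eq_zero] at h1
    refine h1.resolve_left (mul_pos ha (Real.rpow_pos_of_pos (hpos x) _)).ne'
  have hfd : fderiv ℝ u = fun _ => 0 := by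
    ext x v
    rw [← inner_gradient_left, hgrad]
    simp
  have hΔ : Laplacian.laplacian u x₁ = 0 := by
    rw [laplacian_eq_sum_fderiv (stdOrthonormalBasis ℝ _), hfd]
    simp
  have heq := hu.equation x₁ (Set.mem_univ x₁)
  rw [hΔ, hgrad, norm_zero, Real.zero_rpow (by linarith), abs_of_pos (hpos x₁)] at heq
  have : 0 < u x₁ ^ (p - 1) * u x₁ := mul_pos (Real.rpow_pos_of_pos (hpos x₁) _) (hpos x₁)
  linarith
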